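/- Let $A$ be the mod $2$ Steenrod algebra, that is, the graded associative unital $\mathbb{F}_2$-algebra generated by the Steenrod squares $\mathrm{Sq}^n$ ($n\ge 0$), with $\mathrm{Sq}^n$ in degree $n$, subject to $\mathrm{Sq}^0=1$ and the Adem relations $$\mathrm{Sq}^a\mathrm{Sq}^b=\sum_{c=0}^{\lfloor a/2\rfloor}\binom{b-1-c}{a-2c}\,\mathrm{Sq}^{a+b-c}\mathrm{Sq}^c\qquad(0<a<2b).$$ Work in the abelian category of $\mathbb{Z}$-graded left $A$-modules and degree-preserving $A$-linear maps, and let $\mathrm{Hom}_A$ and $\mathrm{Ext}^s_A$ denote morphisms and Ext groups in this category. Let $\mathbb{F}_2$ be the trivial module concentrated in degree $0$ (every $\mathrm{Sq}^n$ with $n>0$ acts as zero), and for $t\in\mathbb{Z}$ let $\Sigma^t M$ be the $t$-fold suspension, $(\Sigma^tM)_j=M_{j-t}$. Then: 1. $\mathrm{Hom}_A(\mathbb{F}_2,\mathbb{F}_2)\cong\mathbb{F}_2$, generated by the identity, and likewise $\mathrm{Hom}_A(\mathbb{F}_2,\Sigma^0\mathbb{F}_2)\cong\mathbb{F}_2$.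 If $t\neq 0$, then $\mathrm{Hom}_A(\mathbb{F}_2,\Sigma^t\mathbb{F}_2)=0$. 2. $\mathrm{Ext}^1_A(\mathbb{F}_2,\Sigma^t\mathbb{F}_2)\cong\mathbb{F}_2$ if $t=2^i$ for some integer $i\ge 0$; for every other $t\in\mathbb{Z}$ this group is zero. (The isomorphisms are of $\mathbb{F}_2$-vector spaces; the nonzero class for $t=2^i$ is called $h_i$.) -/

import Mathlib

open CategoryTheory CategoryTheory.Limits

noncomputable section

namespace Steenrod

/-- The defining relations of the mod 2 Steenrod algebra among the free generators
`Sq^0, Sq^1, Sq^2, …`: the relation `Sq^0 = 1` and, for `0 < a < 2b`, the Adem relation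
`Sq^a Sq^b = ∑_{0 ≤ c ≤ a/2} (b - 1 - c choose a - 2c) Sq^{a+b-c} Sq^c`.
(No subtraction is truncated here, since `c ≤ a / 2 < b`.) -/
inductive AdemRel : FreeAlgebra (ZMod 2) ℕ → FreeAlgebra (ZMod 2) ℕ → Prop
  | sq_zero : AdemRel (FreeAlgebra.ι (ZMod 2) 0) 1
  | adem (a b : ℕ) (ha : 0 < a) (hab : a < 2 * b) :
      AdemRel (FreeAlgebra.ι (ZMod 2) a * FreeAlgebra.ι (ZMod 2) b)
        (∑ c ∈ Finset.range (a / 2 + 1),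
          ((b - 1 - c).choose (a - 2 * c) : ZMod 2) •
            (FreeAlgebra.ι (ZMod 2) (a + b - c) * FreeAlgebra.ι (ZMod 2) c))

/-- The mod 2 Steenrod algebra `A`. -/
abbrev SteenrodAlgebra : Type := RingQuot AdemRel

/-- The Steenrod square `Sq^n`. -/
def Sq (n : ℕ) : SteenrodAlgebra :=
  RingQuot.mkAlgHom (ZMod 2) AdemRel (FreeAlgebra.ι (ZMod 2) n)

/-- The homogeneous part `A_n`: the span of the monomials `Sq^{i_1} ⋯ Sq^{i_r}` with
`i_1 + ⋯ + i_r = n`. -/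
def deg (n : ℕ) : Submodule (ZMod 2) SteenrodAlgebra :=
  Submodule.span (ZMod 2) {x | ∃ l : List ℕ, l.sum = n ∧ (l.map Sq).prod = x}

instance deg_gradedMonoid : SetLike.GradedMonoid deg where
  one_mem := Submodule.subset_span ⟨[], rfl, rfl⟩
  mul_mem := by
    intro i j a b ha hb
    have h : a * b ∈ deg i * deg j := Submodule.mul_mem_mul ha hb
    rw [deg, deg, Submodule.span_mul_span] at h
    refine Submodule.span_mono ?_ h
    rintro _ ⟨_, ⟨l, rfl, rfl⟩, _, ⟨m, rfl, rfl⟩, rfl⟩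
    exact ⟨l ++ m, by simp, by simp⟩

/-- The augmentation `A → 𝔽₂`, the algebra map with `Sq^n ↦ 0` for `n > 0`. -/
def augmentation : SteenrodAlgebra →ₐ[ZMod 2] ZMod 2 :=
  RingQuot.liftAlgHom (ZMod 2)
    ⟨FreeAlgebra.lift (ZMod 2) (fun n : ℕ => if n = 0 then (1 : ZMod 2) else 0), by
      intro x y h
      induction h with
      | sq_zero => simp
      | adem a b ha hab =>
        have h1 : ∀ c ∈ Finset.range (a / 2 + 1), a + b - c ≠ 0 := by
          intro c hc
          rw [Finset.mem_range] at hc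
          omega
        simp only [map_mul, map_sum, map_smul, FreeAlgebra.lift_ι_apply]
        rw [if_neg (by omega), zero_mul, Finset.sum_eq_zero]
        intro c hc
        rw [if_neg (h1 c hc), zero_mul, smul_zero]⟩

theorem augmentation_sq (n : ℕ) : augmentation (Sq n) = if n = 0 then 1 else 0 := by
  simp [augmentation, Sq]

theorem augmentation_deg {n : ℕ} (hn : n ≠ 0) {a : SteenrodAlgebra} (ha : a ∈ deg n) :
    augmentation a = 0 := by
  suffices h : deg n ≤ LinearMap.ker augmentation.toLinearMap from h ha
  refine Submodule.span_le.2 ?_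
  rintro _ ⟨l, rfl, rfl⟩
  have : ∃ i ∈ l, i ≠ 0 := by
    by_contra! h
    exact hn (List.sum_eq_zero h)
  obtain ⟨i, hi, hi0⟩ := this
  simp only [SetLike.mem_coe, LinearMap.mem_ker, AlgHom.toLinearMap_apply, map_list_prod,
    List.map_map]
  refine List.prod_eq_zero (List.mem_map.2 ⟨i, hi, ?_⟩)
  simp [augmentation_sq, hi0]

/-- A (`ℤ`-)graded left module over the Steenrod algebra: a family of `𝔽₂`-vector spaces
`M_j` with bilinear, unital and associative actions `A_i × M_j → M_k` for `i + j = k`. -/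
structure GrMod where
  carrier : ℤ → Type
  [addCommGroup : ∀ j, AddCommGroup (carrier j)]
  [module : ∀ j, Module (ZMod 2) (carrier j)]
  act : ∀ {i : ℕ} {j k : ℤ}, (i : ℤ) + j = k →
    (deg i →ₗ[ZMod 2] carrier j →ₗ[ZMod 2] carrier k)
  one_act : ∀ {j : ℤ} (h : ((0 : ℕ) : ℤ) + j = j) (x : carrier j),
    act h ⟨1, SetLike.GradedOne.one_mem⟩ x = x
  mul_act : ∀ {i i' : ℕ} {j k l : ℤ} (h : (i' : ℤ) + j = k) (h' : (i : ℤ) + k = l)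
    (h'' : ((i + i' : ℕ) : ℤ) + j = l) (a : deg i) (b : deg i') (x : carrier j),
    act h'' ⟨a * b, SetLike.GradedMul.mul_mem a.2 b.2⟩ x = act h' a (act h b x)

namespace GrMod

attribute [instance] GrMod.addCommGroup GrMod.module

/-- Morphisms of graded modules: degree-preserving `A`-linear maps. -/
@[ext]
structure Hom (M N : GrMod) where
  app : ∀ j, M.carrier j →ₗ[ZMod 2] N.carrier j
  app_act : ∀ {i : ℕ} {j k : ℤ} (h : (i : ℤ) + j = k) (a : deg i) (x : M.carrier j),
    app k (M.act h a x) = N.act h a (app j x)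

instance category : Category GrMod where
  Hom := Hom
  id M := ⟨fun _ => LinearMap.id, fun _ _ _ => rfl⟩
  comp f g := ⟨fun j => g.app j ∘ₗ f.app j, fun h a x => by simp [f.app_act, g.app_act]⟩

theorem hom_ext {M N : GrMod} {f g : M ⟶ N} (h : ∀ j x, f.app j x = g.app j x) : f = g :=
  Hom.ext (funext fun j => LinearMap.ext (h j))

@[simp] theorem id_app (M : GrMod) (j : ℤ) : Hom.app (𝟙 M) j = LinearMap.id := rfl

@[simp] theorem comp_app {M N P : GrMod} (f : M ⟶ N) (g : N ⟶ P) (j : ℤ) :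
    (f ≫ g).app j = g.app j ∘ₗ f.app j := rfl

instance homZero (M N : GrMod) : Zero (M ⟶ N) := ⟨⟨fun _ => 0, fun _ _ _ => by simp⟩⟩

instance homAdd (M N : GrMod) : Add (M ⟶ N) :=
  ⟨fun f g => ⟨fun j => f.app j + g.app j, fun h a x => by simp [f.app_act, g.app_act]⟩⟩

instance homNeg (M N : GrMod) : Neg (M ⟶ N) :=
  ⟨fun f => ⟨fun j => - f.app j, fun h a x => by simp [f.app_act]⟩⟩

instance homAddCommGroup (M N : GrMod) : AddCommGroup (M ⟶ N) where
  nsmul := nsmulRec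
  zsmul := zsmulRec
  add_assoc f g h := hom_ext fun j x => add_assoc (f.app j x) (g.app j x) (h.app j x)
  zero_add f := hom_ext fun j x => zero_add (f.app j x)
  add_zero f := hom_ext fun j x => add_zero (f.app j x)
  neg_add_cancel f := hom_ext fun j x => neg_add_cancel (f.app j x)
  add_comm f g := hom_ext fun j x => add_comm (f.app j x) (g.app j x)

@[simp] theorem zero_app {M N : GrMod} (j : ℤ) : Hom.app (0 : M ⟶ N) j = 0 := rfl

@[simp] theorem add_app {M N : GrMod} (f g : M ⟶ N) (j : ℤ) :
    (f + g).app j = f.app j + g.app j := rfl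

instance homModule (M N : GrMod) : Module (ZMod 2) (M ⟶ N) where
  smul c f := ⟨fun j => c • f.app j, fun h a x => by simp [f.app_act]⟩
  one_smul f := hom_ext fun j x => one_smul _ (f.app j x)
  mul_smul c d f := hom_ext fun j x => mul_smul c d (f.app j x)
  smul_zero c := hom_ext fun j _ => smul_zero c
  smul_add c f g := hom_ext fun j x => smul_add c (f.app j x) (g.app j x)
  add_smul c d f := hom_ext fun j x => add_smul c d (f.app j x)
  zero_smul f := hom_ext fun j x => zero_smul _ (f.app j x)

@[simp] theorem smul_app {M N : GrMod} (c : ZMod 2) (f : M ⟶ N) (j : ℤ) :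
    (c • f).app j = c • f.app j := rfl

instance preadditive : Preadditive GrMod where
  homGroup := homAddCommGroup
  add_comp _ _ _ _ _ g := hom_ext fun j _ => map_add (g.app j) _ _
  comp_add _ _ _ _ _ _ := rfl

instance linear : Linear (ZMod 2) GrMod where
  homModule := homModule
  smul_comp _ _ _ c f g := hom_ext fun j x => map_smul (g.app j) c (f.app j x)
  comp_smul _ _ _ _ _ _ := rfl

/-- The graded submodule given by a family of subspaces stable under the action. -/
def sub (M : GrMod) (S : ∀ j, Submodule (ZMod 2) (M.carrier j))
    (hS : ∀ {i : ℕ} {j k : ℤ} (h : (i : ℤ) + j = k) (a : deg i) (x : M.carrier j),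
      x ∈ S j → M.act h a x ∈ S k) : GrMod where
  carrier j := S j
  act h := LinearMap.mk₂ (ZMod 2) (fun a x => ⟨M.act h a x, hS h a x x.2⟩)
    (fun a b x => Subtype.ext (by simp)) (fun c a x => Subtype.ext (by simp))
    (fun a x y => Subtype.ext (by simp)) (fun c a x => Subtype.ext (by simp))
  one_act h x := Subtype.ext (M.one_act h x)
  mul_act h h' h'' a b x := Subtype.ext (M.mul_act h h' h'' a b x)

/-- The quotient of a graded module by a family of subspaces stable under the action. -/
def quot (M : GrMod) (S : ∀ j, Submodule (ZMod 2) (M.carrier j))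
    (hS : ∀ {i : ℕ} {j k : ℤ} (h : (i : ℤ) + j = k) (a : deg i) (x : M.carrier j),
      x ∈ S j → M.act h a x ∈ S k) : GrMod where
  carrier j := M.carrier j ⧸ S j
  act {i j k} h :=
    { toFun a := (S j).mapQ (S k) (M.act h a) (fun x hx => hS h a x hx)
      map_add' a b := Submodule.linearMap_qext _ (LinearMap.ext fun x => by simp)
      map_smul' c a := Submodule.linearMap_qext _ (LinearMap.ext fun x => by simp) }
  one_act {j} h x := by
    obtain ⟨x, rfl⟩ := (S j).mkQ_surjective x
    exact congrArg (S j).mkQ (M.one_act h x)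
  mul_act {i i' j k l} h h' h'' a b x := by
    obtain ⟨x, rfl⟩ := (S j).mkQ_surjective x
    exact congrArg (S l).mkQ (M.mul_act h h' h'' a b x)

/-- The degreewise kernel. -/
def ker {M N : GrMod} (f : M ⟶ N) : GrMod :=
  M.sub (fun j => LinearMap.ker (f.app j)) fun h a x hx => by
    rw [LinearMap.mem_ker] at hx ⊢
    rw [f.app_act, hx, map_zero]

/-- The inclusion of the kernel. -/
def kerι {M N : GrMod} (f : M ⟶ N) : ker f ⟶ M :=
  ⟨fun j => (LinearMap.ker (f.app j)).subtype, fun _ _ _ => rfl⟩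

theorem kerι_comp {M N : GrMod} (f : M ⟶ N) : kerι f ≫ f = 0 :=
  hom_ext fun _ x => x.2

/-- The degreewise cokernel. -/
def coker {M N : GrMod} (f : M ⟶ N) : GrMod :=
  N.quot (fun j => LinearMap.range (f.app j)) fun h a x hx => by
    obtain ⟨y, rfl⟩ := hx
    exact ⟨M.act h a y, f.app_act h a y⟩

/-- The projection onto the cokernel. -/
def cokerπ {M N : GrMod} (f : M ⟶ N) : N ⟶ coker f :=
  ⟨fun j => (LinearMap.range (f.app j)).mkQ, fun _ _ _ => rfl⟩

theorem comp_cokerπ {M N : GrMod} (f : M ⟶ N) : f ≫ cokerπ f = 0 :=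
  hom_ext fun _ x => (Submodule.Quotient.mk_eq_zero _).2 ⟨x, rfl⟩

theorem injective_of_mono {M N : GrMod} (f : M ⟶ N) [Mono f] (j : ℤ) :
    Function.Injective (f.app j) := by
  have h : kerι f = 0 := by
    rw [← cancel_mono f, kerι_comp, zero_comp]
  rw [injective_iff_map_eq_zero]
  intro x hx
  exact congrArg (fun g : ker f ⟶ M => g.app j ⟨x, hx⟩) h

theorem surjective_of_epi {M N : GrMod} (f : M ⟶ N) [Epi f] (j : ℤ) :
    Function.Surjective (f.app j) := by
  have h : cokerπ f = 0 := by
    rw [← cancel_epi f, comp_cokerπ, comp_zero]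
  intro x
  have hx := congrArg (fun g : N ⟶ coker f => g.app j x) h
  exact (Submodule.Quotient.mk_eq_zero _).1 hx

/-- A family of linear maps into an injective family through which a morphism factors
is a morphism. -/
def liftOfInjective {M N P : GrMod} (f : M ⟶ N) (hf : ∀ j, Function.Injective (f.app j))
    (g : P ⟶ N) (hg : ∀ j x, g.app j x ∈ LinearMap.range (f.app j)) : P ⟶ M where
  app j := (LinearEquiv.ofInjective (f.app j) (hf j)).symm.toLinearMap ∘ₗ
    (g.app j).codRestrict _ (hg j)
  app_act {i j k} h a x := by
    have key : ∀ j (x : P.carrier j), f.app j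
        ((LinearEquiv.ofInjective (f.app j) (hf j)).symm ⟨g.app j x, hg j x⟩) = g.app j x :=
      fun j x => congrArg Subtype.val
        ((LinearEquiv.ofInjective (f.app j) (hf j)).apply_symm_apply ⟨g.app j x, hg j x⟩)
    apply hf
    refine (key k _).trans ?_
    rw [f.app_act, g.app_act]
    exact congrArg _ (key j x).symm

theorem liftOfInjective_comp {M N P : GrMod} (f : M ⟶ N)
    (hf : ∀ j, Function.Injective (f.app j))
    (g : P ⟶ N) (hg : ∀ j x, g.app j x ∈ LinearMap.range (f.app j)) :
    liftOfInjective f hf g hg ≫ f = g :=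
  hom_ext fun j x => congrArg Subtype.val
    ((LinearEquiv.ofInjective (f.app j) (hf j)).apply_symm_apply ⟨g.app j x, hg j x⟩)

theorem mono_of_injective {M N : GrMod} (f : M ⟶ N)
    (hf : ∀ j, Function.Injective (f.app j)) : Mono f where
  right_cancellation _ _ hgh := hom_ext fun j x =>
    hf j (congrArg (fun u : _ ⟶ N => u.app j x) hgh)

theorem epi_of_surjective {M N : GrMod} (f : M ⟶ N)
    (hf : ∀ j, Function.Surjective (f.app j)) : Epi f where
  left_cancellation _ _ hgh := hom_ext fun j x => by
    obtain ⟨y, rfl⟩ := hf j x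
    exact congrArg (fun u : M ⟶ _ => u.app j y) hgh

/-- A morphism that kills the kernel of a degreewise surjective morphism factors through it. -/
def descOfSurjective {M N P : GrMod} (f : M ⟶ N) (hf : ∀ j, Function.Surjective (f.app j))
    (g : M ⟶ P) (hg : ∀ j, LinearMap.ker (f.app j) ≤ LinearMap.ker (g.app j)) : N ⟶ P where
  app j := (LinearMap.ker (f.app j)).liftQ (g.app j) (hg j) ∘ₗ
    ((f.app j).quotKerEquivOfSurjective (hf j)).symm.toLinearMap
  app_act {i j k} h a x := by
    have key : ∀ j (x : M.carrier j), (LinearMap.ker (f.app j)).liftQ (g.app j) (hg j)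
        (((f.app j).quotKerEquivOfSurjective (hf j)).symm (f.app j x)) = g.app j x := by
      intro j x
      have : ((f.app j).quotKerEquivOfSurjective (hf j)).symm (f.app j x) =
          Submodule.Quotient.mk x := by
        rw [LinearEquiv.symm_apply_eq]; rfl
      rw [this]; rfl
    obtain ⟨y, rfl⟩ := hf j x
    rw [← f.app_act]
    refine (key k _).trans ?_
    rw [g.app_act]
    exact congrArg _ (key j y).symm

theorem comp_descOfSurjective {M N P : GrMod} (f : M ⟶ N)
    (hf : ∀ j, Function.Surjective (f.app j))
    (g : M ⟶ P) (hg : ∀ j, LinearMap.ker (f.app j) ≤ LinearMap.ker (g.app j)) :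
    f ≫ descOfSurjective f hf g hg = g := by
  refine hom_ext fun j x => ?_
  have : ((f.app j).quotKerEquivOfSurjective (hf j)).symm (f.app j x) =
      Submodule.Quotient.mk x := by
    rw [LinearEquiv.symm_apply_eq]; rfl
  change (LinearMap.ker (f.app j)).liftQ (g.app j) (hg j)
        (((f.app j).quotKerEquivOfSurjective (hf j)).symm (f.app j x)) = g.app j x
  rw [this]; rfl

/-- An injective morphism is the kernel of every morphism it is degreewise exact with. -/
def isLimitOfExact {M N P : GrMod} (f : M ⟶ N) (g : N ⟶ P) (w : f ≫ g = 0)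
    (hf : ∀ j, Function.Injective (f.app j))
    (h : ∀ j, LinearMap.ker (g.app j) ≤ LinearMap.range (f.app j)) :
    IsLimit (KernelFork.ofι f w) :=
  haveI := mono_of_injective f hf
  KernelFork.IsLimit.ofι' f w fun {Q} k hk =>
    ⟨liftOfInjective f hf k fun j x =>
        h j (congrArg (fun u : Q ⟶ P => u.app j x) hk),
      liftOfInjective_comp f hf k _⟩

/-- A surjective morphism is the cokernel of every morphism it is degreewise exact with. -/
def isColimitOfExact {M N P : GrMod} (f : M ⟶ N) (g : N ⟶ P) (w : f ≫ g = 0)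
    (hg : ∀ j, Function.Surjective (g.app j))
    (h : ∀ j, LinearMap.ker (g.app j) ≤ LinearMap.range (f.app j)) :
    IsColimit (CokernelCofork.ofπ g w) :=
  haveI := epi_of_surjective g hg
  CokernelCofork.IsColimit.ofπ' g w fun {Q} k hk =>
    ⟨descOfSurjective g hg k fun j x hx => by
        obtain ⟨y, rfl⟩ := h j hx
        exact congrArg (fun u : M ⟶ Q => u.app j y) hk,
      comp_descOfSurjective g hg k _⟩

instance hasKernels : HasKernels GrMod where
  has_limit f := ⟨⟨_, isLimitOfExact (kerι f) f (kerι_comp f)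
    (fun _ => Subtype.val_injective) (fun _ => (Submodule.range_subtype _).ge)⟩⟩

instance hasCokernels : HasCokernels GrMod where
  has_colimit f := ⟨⟨_, isColimitOfExact f (cokerπ f) (comp_cokerπ f)
    (fun _ => Submodule.mkQ_surjective _) (fun _ => (Submodule.ker_mkQ _).le)⟩⟩

instance isNormalMonoCategory : IsNormalMonoCategory GrMod where
  normalMonoOfMono f _ := ⟨⟨_, cokerπ f, comp_cokerπ f,
    isLimitOfExact f (cokerπ f) (comp_cokerπ f) (injective_of_mono f)
      (fun _ => (Submodule.ker_mkQ _).le)⟩⟩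

instance isNormalEpiCategory : IsNormalEpiCategory GrMod where
  normalEpiOfEpi f _ := ⟨⟨_, kerι f, kerι_comp f,
    isColimitOfExact (kerι f) f (kerι_comp f) (surjective_of_epi f)
      (fun _ => (Submodule.range_subtype _).ge)⟩⟩

/-- The degreewise product. -/
def prod {J : Type} (F : J → GrMod) : GrMod where
  carrier j := ∀ s, (F s).carrier j
  act h := LinearMap.mk₂ (ZMod 2) (fun a x s => (F s).act h a (x s))
    (fun a b x => funext fun s => by simp) (fun c a x => funext fun s => by simp)
    (fun a x y => funext fun s => by simp) (fun c a x => funext fun s => by simp)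
  one_act h x := funext fun s => (F s).one_act h (x s)
  mul_act h h' h'' a b x := funext fun s => (F s).mul_act h h' h'' a b (x s)

instance hasProducts : HasProducts.{0} GrMod :=
  hasProducts_of_limit_fans
    (fun F => Fan.mk (prod F) fun s => ⟨fun _ => LinearMap.proj s, fun _ _ _ => rfl⟩)
    (fun F => Fan.IsLimit.mk _
      (fun c => ⟨fun j => LinearMap.pi fun s => (c.proj s).app j,
        fun h a x => funext fun s => (c.proj s).app_act h a x⟩)
      (fun _ _ => rfl)
      (fun c _ hm => hom_ext fun j x => funext fun s =>
        congrArg (fun u : c.pt ⟶ F s => u.app j x) (hm s)))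

instance hasFiniteProducts : HasFiniteProducts GrMod := hasFiniteProducts_of_hasProducts _

/-- The abelian category of graded left `A`-modules and degree-preserving maps. -/
instance abelian : Abelian GrMod where

instance hasExt : HasExt.{1} GrMod := HasExt.standard GrMod

/-- The degree `j` part of `𝔽₂`: all of `𝔽₂` if `j = 0`, and zero otherwise. -/
def F2part (j : ℤ) : Submodule (ZMod 2) (ZMod 2) := if j = 0 then ⊤ else ⊥

theorem augmentation_mul_mem {i : ℕ} {j k : ℤ} (h : (i : ℤ) + j = k) {a : SteenrodAlgebra}
    (ha : a ∈ deg i) {x : ZMod 2} (hx : x ∈ F2part j) : augmentation a * x ∈ F2part k := by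
  by_cases hj : j = 0
  · by_cases hi : i = 0
    · have hk : k = 0 := by omega
      simp [F2part, hk]
    · rw [augmentation_deg hi ha, zero_mul]
      exact zero_mem _
  · rw [F2part, if_neg hj, Submodule.mem_bot] at hx
    rw [hx, mul_zero]
    exact zero_mem _

/-- The ground field `𝔽₂`, concentrated in degree `0`, on which `A` acts through the
augmentation. -/
def F2 : GrMod where
  carrier j := F2part j
  act h := LinearMap.mk₂ (ZMod 2)
    (fun a x => ⟨augmentation a * x, augmentation_mul_mem h a.2 x.2⟩)
    (fun a b x => Subtype.ext (by simp [add_mul]))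
    (fun c a x => Subtype.ext (by simp [mul_assoc]))
    (fun a x y => Subtype.ext (by simp [mul_add]))
    (fun c a x => Subtype.ext (by simp [mul_left_comm]))
  one_act h x := Subtype.ext (by simp)
  mul_act h h' h'' a b x := Subtype.ext (by simp [mul_assoc])

/-- The suspension `Σ^t M`, with `(Σ^t M)_j = M_{j - t}` and the same action
(there are no signs in characteristic `2`). -/
def susp (t : ℤ) (M : GrMod) : GrMod where
  carrier j := M.carrier (j - t)
  act h := M.act (by omega)
  one_act h x := M.one_act _ x
  mul_act h h' h'' a b x := M.mul_act _ _ _ a b x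

end GrMod

end Steenrod

end

/-!
The morphisms `𝔽₂ → M` embed in `M_0` by evaluation at the generator, which gives the statements
on `Hom`.

For `Ext¹`, let `I` be the augmentation ideal of `A`. In `0 → I → A → 𝔽₂ → 0` the middle term is
free of rank one, hence projective (`projective_free`), and every morphism `A → Σ^t 𝔽₂` vanishes
on `I` (`kerι_comp_eq_zero`), so the connecting map `Hom(I, Σ^t 𝔽₂) → Ext¹(𝔽₂, Σ^t 𝔽₂)` is an
isomorphism (`nonempty_hom_linearEquiv_ext_one`). A morphism `I → Σ^t 𝔽₂` is a linear form on
`I_t` that vanishes on decomposables. Modulo decomposables `I_t` is spanned by `Sq^t`, so such a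
form is determined by its value there (`augIdeal_hom_eq_zero`).

If `t` is not a power of `2`, an Adem relation shows that `Sq^t` is decomposable
(`sq_mem_decomposables`), and the form is zero. If `t = 2^k`, sending `Sq^t` to `ε` and all other
positive squares to `0` respects the Adem relations and defines an algebra map `A → 𝔽₂[ε]`
(`toDualNumber`), whose `ε`-coordinate is a form with value `1` at `Sq^t`. Both facts are
congruences of binomial coefficients modulo `2`; no basis of `A` is needed.
-/

noncomputable section

/-! ### Binomial coefficients modulo `2` -/

/-- Lucas' theorem at the prime `2`, for the last binary digit. -/
theorem choose_eq_mod_two_mul_div_two (m a : ℕ) :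
    (m.choose a : ZMod 2) = (m % 2).choose (a % 2) * (m / 2).choose (a / 2) := by
  have : Fact (Nat.Prime 2) := ⟨Nat.prime_two⟩
  exact_mod_cast (ZMod.natCast_eq_natCast_iff _ _ 2).2
    (Choose.choose_modEq_choose_mod_mul_choose_div_nat (n := m) (k := a) (p := 2))

theorem choose_two_pow_sub_one (k : ℕ) : ∀ m a : ℕ, m + 1 = 2 ^ k → a ≤ m →
    (m.choose a : ZMod 2) = 1 := by
  induction k with
  | zero =>
    intro m a hm ha
    obtain rfl : m = 0 := by simpa using hm
    obtain rfl : a = 0 := by omega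
    simp
  | succ k ih =>
    intro m a hm ha
    rw [pow_succ] at hm
    rw [choose_eq_mod_two_mul_div_two, ih (m / 2) (a / 2) (by omega) (by omega),
      show m % 2 = 1 by omega]
    rcases Nat.mod_two_eq_zero_or_one a with h | h <;> simp [h]

/-- The binary digits of `m` and `a` are complementary, so a binary digit `1` of `a` meets a
digit `0` of `m`. -/
theorem choose_of_add_add_one_eq_two_pow (k : ℕ) : ∀ m a : ℕ, m + a + 1 = 2 ^ k → 0 < a →
    (m.choose a : ZMod 2) = 0 := by
  induction k with
  | zero =>
    intro m a hm ha
    rw [pow_zero] at hm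
    omega
  | succ k ih =>
    intro m a hm ha
    rw [pow_succ] at hm
    rw [choose_eq_mod_two_mul_div_two]
    rcases Nat.mod_two_eq_zero_or_one a with h | h
    · rw [ih (m / 2) (a / 2) (by omega) (by omega), mul_zero]
    · rw [h, show m % 2 = 0 by omega]
      simp

namespace Steenrod

/-! ### Indecomposables of the Steenrod algebra -/

theorem sq_zero : Sq 0 = 1 := by
  have h := RingQuot.mkAlgHom_rel (ZMod 2) AdemRel.sq_zero
  rwa [map_one] at h

theorem sq_mul_sq {a b : ℕ} (ha : 0 < a) (hab : a < 2 * b) :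
    Sq a * Sq b = ∑ c ∈ Finset.range (a / 2 + 1),
      ((b - 1 - c).choose (a - 2 * c) : ZMod 2) • (Sq (a + b - c) * Sq c) := by
  have h := RingQuot.mkAlgHom_rel (ZMod 2) (AdemRel.adem a b ha hab)
  simp only [map_mul, map_sum, map_smul] at h
  exact h

theorem sq_mem_deg (n : ℕ) : Sq n ∈ deg n :=
  Submodule.subset_span ⟨[n], by simp, by simp⟩

/-- The decomposable elements of degree `n`: the span of the products of two homogeneous
elements of positive degree. -/
def decomposables (n : ℕ) : Submodule (ZMod 2) SteenrodAlgebra :=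
  Submodule.span (ZMod 2)
    {z | ∃ i j, 0 < i ∧ 0 < j ∧ i + j = n ∧ ∃ x ∈ deg i, ∃ y ∈ deg j, x * y = z}

theorem mul_mem_decomposables {i j n : ℕ} (hi : 0 < i) (hj : 0 < j) (hn : i + j = n)
    {x y : SteenrodAlgebra} (hx : x ∈ deg i) (hy : y ∈ deg j) : x * y ∈ decomposables n :=
  Submodule.subset_span ⟨i, j, hi, hj, hn, x, hx, y, hy, rfl⟩

theorem prod_sq_eq_one : ∀ l : List ℕ, l.sum = 0 → (l.map Sq).prod = 1
  | [], _ => rfl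
  | n :: l, h => by
    rw [List.sum_cons] at h
    obtain rfl : n = 0 := by omega
    rw [List.map_cons, List.prod_cons, prod_sq_eq_one l (by omega), sq_zero, one_mul]

theorem deg_zero_le : deg 0 ≤ Submodule.span (ZMod 2) {1} := by
  refine Submodule.span_le.2 ?_
  rintro _ ⟨l, hl, rfl⟩
  rw [prod_sq_eq_one l hl]
  exact Submodule.mem_span_singleton_self 1

theorem prod_sq_mem : ∀ (l : List ℕ) (n : ℕ), 0 < n → l.sum = n →
    (l.map Sq).prod ∈ Submodule.span (ZMod 2) {Sq n} ⊔ decomposables n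
  | [], n, hn, h => by simp at h; omega
  | m :: l, n, hn, h => by
    rw [List.sum_cons] at h
    rw [List.map_cons, List.prod_cons]
    rcases Nat.eq_zero_or_pos m with rfl | hm
    · rw [sq_zero, one_mul]
      exact prod_sq_mem l n hn (by omega)
    · rcases Nat.eq_zero_or_pos l.sum with hl | hl
      · obtain rfl : m = n := by omega
        rw [prod_sq_eq_one l hl, mul_one]
        exact Submodule.mem_sup_left (Submodule.mem_span_singleton_self _)
      · exact Submodule.mem_sup_right (mul_mem_decomposables hm hl h (sq_mem_deg m)
          (Submodule.subset_span ⟨l, rfl, rfl⟩))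

theorem deg_le_span_sq_sup_decomposables {n : ℕ} (hn : 0 < n) :
    deg n ≤ Submodule.span (ZMod 2) {Sq n} ⊔ decomposables n := by
  refine Submodule.span_le.2 ?_
  rintro _ ⟨l, hl, rfl⟩
  exact prod_sq_mem l n hn hl

/-- If `2 ^ k < n < 2 ^ (k + 1)`, the Adem relation for `Sq^{n - 2^k} Sq^{2^k}` has `Sq^n` as
its `c = 0` term, and all its other terms are decomposable. -/
theorem sq_mem_decomposables {n : ℕ} (hn : 0 < n) (h : ¬ ∃ i : ℕ, n = 2 ^ i) :
    Sq n ∈ decomposables n := by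
  obtain ⟨k, hk, hk'⟩ : ∃ k, 2 ^ k < n ∧ n < 2 ^ k * 2 := by
    refine ⟨Nat.log 2 n, lt_of_le_of_ne (Nat.pow_log_le_self 2 hn.ne') fun e => h ⟨_, e.symm⟩, ?_⟩
    rw [← pow_succ]
    exact Nat.lt_pow_succ_log_self one_lt_two n
  have hb : 0 < 2 ^ k := by positivity
  have key := sq_mul_sq (a := n - 2 ^ k) (b := 2 ^ k) (by omega) (by omega)
  rw [Finset.sum_range_succ', Nat.sub_zero, Nat.mul_zero, Nat.sub_zero,
    choose_two_pow_sub_one k _ _ (by omega) (by omega), one_smul, sq_zero, mul_one,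
    Nat.sub_zero, Nat.sub_add_cancel hk.le, ← sub_eq_iff_eq_add'] at key
  rw [← key]
  refine Submodule.sub_mem _ (mul_mem_decomposables (by omega) hb (by omega) (sq_mem_deg _)
    (sq_mem_deg _)) (Submodule.sum_mem _ fun c hc => Submodule.smul_mem _ _ ?_)
  rw [Finset.mem_range] at hc
  exact mul_mem_decomposables (by omega) (by omega) (by omega) (sq_mem_deg _) (sq_mem_deg _)

/-- The algebra map `A → 𝔽₂[ε]` with `Sq^{2^k} ↦ ε` and `Sq^n ↦ 0` for every other `n > 0`.
It respects the Adem relations because `Sq^{2^k}` occurs in none of those of degree `2^k`: its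
coefficient in `Sq^a Sq^b` is `(2^k - a - 1 choose a)`, which is even. -/
def toDualNumber (k : ℕ) : SteenrodAlgebra →ₐ[ZMod 2] DualNumber (ZMod 2) :=
  RingQuot.liftAlgHom (ZMod 2)
    ⟨FreeAlgebra.lift (ZMod 2) (fun n : ℕ =>
        if n = 0 then (1 : DualNumber (ZMod 2)) else if n = 2 ^ k then DualNumber.eps else 0), by
      intro x y h
      induction h with
      | sq_zero => simp
      | adem a b ha hab =>
        simp only [map_mul, map_sum, map_smul, FreeAlgebra.lift_ι_apply]
        rw [Finset.sum_range_succ', Finset.sum_eq_zero, if_neg ha.ne', if_neg (by omega : b ≠ 0)]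
        · simp only [Nat.sub_zero, Nat.mul_zero]
          rw [if_neg (by omega : a + b ≠ 0), if_pos trivial, mul_one, zero_add]
          have h0 : (if a = 2 ^ k then (DualNumber.eps : DualNumber (ZMod 2)) else 0) *
              (if b = 2 ^ k then DualNumber.eps else 0) = 0 := by
            split_ifs <;> simp
          rw [h0]
          split_ifs with hab'
          · rw [choose_of_add_add_one_eq_two_pow k _ _ (by omega) ha, zero_smul]
          · rw [smul_zero]
        · intro c hc
          rw [Finset.mem_range] at hc
          rw [if_neg (by omega : a + b - (c + 1) ≠ 0), if_neg (by omega : c + 1 ≠ 0)]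
          split_ifs <;> simp⟩

theorem toDualNumber_sq (k n : ℕ) : toDualNumber k (Sq n) =
    if n = 0 then 1 else if n = 2 ^ k then DualNumber.eps else 0 := by
  simp [toDualNumber, Sq]

theorem fst_toDualNumber (k : ℕ) (x : SteenrodAlgebra) :
    TrivSqZeroExt.fst (toDualNumber k x) = augmentation x := by
  suffices h : (TrivSqZeroExt.fstHom (ZMod 2) (ZMod 2) (ZMod 2)).comp (toDualNumber k) =
      augmentation from DFunLike.congr_fun h x
  refine RingQuot.ringQuot_ext' (ZMod 2) _ _ (FreeAlgebra.hom_ext (funext fun n => ?_))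
  change TrivSqZeroExt.fst (toDualNumber k (Sq n)) = augmentation (Sq n)
  rw [toDualNumber_sq, augmentation_sq]
  split_ifs <;> simp

/-- The `ε`-coordinate of `toDualNumber`. It is a derivation over the augmentation, so it
vanishes on decomposables, and it detects `Sq^{2^k}`. -/
def sqDual (k : ℕ) : SteenrodAlgebra →ₗ[ZMod 2] ZMod 2 :=
  (TrivSqZeroExt.sndHom (ZMod 2) (ZMod 2)) ∘ₗ (toDualNumber k).toLinearMap

theorem sqDual_sq (k : ℕ) : sqDual k (Sq (2 ^ k)) = 1 := by
  change TrivSqZeroExt.snd (toDualNumber k (Sq (2 ^ k))) = 1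
  rw [toDualNumber_sq, if_neg (Nat.two_pow_pos k).ne', if_pos rfl, DualNumber.snd_eps]

theorem sqDual_mul (k : ℕ) (x y : SteenrodAlgebra) :
    sqDual k (x * y) = augmentation x * sqDual k y + augmentation y * sqDual k x := by
  change TrivSqZeroExt.snd (toDualNumber k (x * y)) = _
  rw [map_mul, TrivSqZeroExt.snd_mul, fst_toDualNumber, fst_toDualNumber,
    op_smul_eq_smul]
  rfl

/-! ### The free graded module of rank one -/

/-- The grading of the Steenrod algebra extended to `ℤ` by zero in negative degrees. -/
def degZ : ℤ → Submodule (ZMod 2) SteenrodAlgebra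
  | Int.ofNat n => deg n
  | Int.negSucc _ => ⊥

theorem mul_mem_degZ {i : ℕ} {j k : ℤ} (h : (i : ℤ) + j = k) {a x : SteenrodAlgebra}
    (ha : a ∈ deg i) (hx : x ∈ degZ j) : a * x ∈ degZ k := by
  match j, hx with
  | Int.ofNat n, hx =>
    obtain rfl : k = Int.ofNat (i + n) := by simp [← h]
    exact SetLike.GradedMul.mul_mem ha hx
  | Int.negSucc n, hx =>
    obtain rfl : x = 0 := hx
    rw [mul_zero]
    exact zero_mem _

namespace GrMod

/-- The Steenrod algebra as a graded left module over itself. -/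
def free : GrMod where
  carrier j := degZ j
  act h := LinearMap.mk₂ (ZMod 2)
    (fun a x => ⟨a * x, mul_mem_degZ h a.2 x.2⟩)
    (fun a b x => Subtype.ext (by simp [add_mul]))
    (fun c a x => Subtype.ext (by simp))
    (fun a x y => Subtype.ext (by simp [mul_add]))
    (fun c a x => Subtype.ext (by simp))
  one_act h x := Subtype.ext (by simp)
  mul_act h h' h'' a b x := Subtype.ext (by simp [mul_assoc])

/-- The generator of the free graded module. -/
def free.one : free.carrier 0 :=
  (⟨1, SetLike.GradedOne.one_mem⟩ : deg 0)

/-- The morphism from the free graded module sending the generator to `m`. -/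
def freeDesc {M : GrMod} (m : M.carrier 0) : free ⟶ M where
  app
    | Int.ofNat n => (M.act (i := n) (k := Int.ofNat n) (add_zero _)).flip m
    | Int.negSucc _ => 0
  app_act {i j k} h a x := by
    match j, x with
    | Int.ofNat n, x =>
      obtain rfl : k = Int.ofNat (i + n) := by simp [← h]
      exact M.mul_act (j := 0) (add_zero _) h (add_zero _) a x m
    | Int.negSucc n, x =>
      obtain rfl : x = 0 := Subtype.ext x.2
      simp only [map_zero]

theorem freeDesc_one {M : GrMod} (m : M.carrier 0) : (freeDesc m).app 0 free.one = m :=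
  M.one_act _ m

/-- A morphism out of the free graded module is determined by the image of the generator. -/
theorem free_hom_ext {M : GrMod} {f g : free ⟶ M}
    (h : f.app 0 free.one = g.app 0 free.one) : f = g := by
  refine hom_ext fun j x => ?_
  match j, x with
  | Int.ofNat n, x =>
    have hx : x = free.act (i := n) (j := 0) (k := Int.ofNat n) (add_zero _) x free.one :=
      Subtype.ext (mul_one (x.1 : SteenrodAlgebra)).symm
    rw [hx]
    exact (f.app_act (i := n) (add_zero _) x free.one).trans
      ((congrArg _ h).trans (g.app_act (i := n) (add_zero _) x free.one).symm)
  | Int.negSucc n, x =>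
    obtain rfl : x = 0 := Subtype.ext x.2
    simp only [map_zero]

instance projective_free : Projective free where
  factors {E X} f e _ := by
    obtain ⟨m, hm⟩ := surjective_of_epi e 0 (f.app 0 free.one)
    refine ⟨freeDesc m, free_hom_ext ?_⟩
    change e.app 0 ((freeDesc m).app 0 free.one) = _
    rw [freeDesc_one, hm]

/-! ### The augmentation sequence -/

theorem F2part_of_ne {j : ℤ} (hj : j ≠ 0) {x : ZMod 2} (hx : x ∈ F2part j) : x = 0 := by
  rwa [F2part, if_neg hj, Submodule.mem_bot] at hx

theorem mem_F2part {j : ℤ} (hj : j = 0) (x : ZMod 2) : x ∈ F2part j := by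
  rw [F2part, if_pos hj]
  exact Submodule.mem_top

theorem augmentation_mem_F2part {j : ℤ} {x : SteenrodAlgebra} (hx : x ∈ degZ j) :
    augmentation x ∈ F2part j := by
  match j, hx with
  | Int.ofNat n, hx =>
    have h := augmentation_mul_mem (k := Int.ofNat n) (add_zero _) hx (mem_F2part rfl 1)
    rwa [mul_one] at h
  | Int.negSucc n, hx =>
    obtain rfl : x = 0 := hx
    rw [map_zero]
    exact zero_mem _

/-- The augmentation as a morphism of graded modules. -/
def freeToF2 : free ⟶ F2 where
  app j := augmentation.toLinearMap.restrict (p := degZ j) (q := F2part j)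
    fun _ hx => augmentation_mem_F2part hx
  app_act _ a x := Subtype.ext (map_mul augmentation a.1 x.1)

theorem freeToF2_surjective (j : ℤ) : Function.Surjective (freeToF2.app j) := by
  intro x
  by_cases hj : j = 0
  · subst hj
    refine ⟨x.1 • free.one, Subtype.ext ?_⟩
    change augmentation (x.1 • (1 : SteenrodAlgebra)) = x.1
    rw [map_smul, map_one, smul_eq_mul, mul_one]
  · exact ⟨0, Subtype.ext ((congrArg Subtype.val (map_zero (freeToF2.app j))).trans
      (F2part_of_ne hj x.2).symm)⟩

/-- The short exact sequence `0 → I → A → 𝔽₂ → 0`, with `I` the augmentation ideal. -/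
def augSeq : ShortComplex GrMod :=
  ShortComplex.mk (kerι freeToF2) freeToF2 (kerι_comp freeToF2)

theorem augSeq_shortExact : augSeq.ShortExact where
  exact := ShortComplex.exact_of_f_is_kernel _ (isLimitOfExact (kerι freeToF2) freeToF2
    (kerι_comp freeToF2) (fun _ => Subtype.val_injective) (fun _ => (Submodule.range_subtype _).ge))
  mono_f := mono_of_injective _ fun _ => Subtype.val_injective
  epi_g := epi_of_surjective _ freeToF2_surjective

/-! ### Suspensions of the ground field -/

/-- The element of `𝔽₂` underlying an element of `Σ^t 𝔽₂`. -/
def suspVal (t j : ℤ) : (F2.susp t).carrier j →ₗ[ZMod 2] ZMod 2 :=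
  (F2part (j - t)).subtype

theorem suspVal_injective (t j : ℤ) : Function.Injective (suspVal t j) :=
  Subtype.val_injective

theorem suspVal_of_ne {t j : ℤ} (h : j ≠ t) (x : (F2.susp t).carrier j) : suspVal t j x = 0 :=
  F2part_of_ne (sub_ne_zero.2 h) x.2

theorem suspVal_act {t : ℤ} {i : ℕ} {j k : ℤ} (h : (i : ℤ) + j = k) (a : deg i)
    (x : (F2.susp t).carrier j) :
    suspVal t k ((F2.susp t).act h a x) = augmentation a * suspVal t j x :=
  rfl

/-- A linear form as a map to the degree `j` part of `Σ^t 𝔽₂`; it is replaced by zero unless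
`j = t`. -/
def toSusp {V : Type*} [AddCommGroup V] [Module (ZMod 2) V] (t j : ℤ) (φ : V →ₗ[ZMod 2] ZMod 2) :
    V →ₗ[ZMod 2] (F2.susp t).carrier j :=
  (if j = t then φ else 0).codRestrict (F2part (j - t)) fun x => by
    split_ifs with h
    · exact mem_F2part (sub_eq_zero.2 h) _
    · exact zero_mem _

theorem suspVal_toSusp {V : Type*} [AddCommGroup V] [Module (ZMod 2) V] {t j : ℤ}
    (φ : V →ₗ[ZMod 2] ZMod 2) (x : V) :
    suspVal t j (toSusp t j φ x) = (if j = t then φ else 0) x :=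
  rfl

/-- The generator of `𝔽₂` in degree `0`. -/
def F2.one : F2.carrier 0 :=
  (⟨1, mem_F2part rfl 1⟩ : F2part 0)

/-- Evaluation at the generator of `𝔽₂`. -/
def evalOne (M : GrMod) : (F2 ⟶ M) →ₗ[ZMod 2] M.carrier 0 where
  toFun f := f.app 0 F2.one
  map_add' _ _ := rfl
  map_smul' _ _ := rfl

theorem evalOne_injective (M : GrMod) : Function.Injective (evalOne M) := by
  intro f g h
  refine hom_ext fun j x => ?_
  by_cases hj : j = 0
  · subst hj
    have hx : x = x.1 • F2.one := Subtype.ext (mul_one x.1).symm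
    rw [hx, map_smul, map_smul]
    exact congrArg _ h
  · obtain rfl : x = 0 := Subtype.ext (F2part_of_ne hj x.2)
    simp only [map_zero]

/-- The identity of `𝔽₂`, read as a morphism to the zeroth suspension. -/
def toSuspZero : F2 ⟶ F2.susp 0 where
  app j := (LinearMap.id (R := ZMod 2) (M := ZMod 2)).restrict (p := F2part j) (q := F2part (j - 0))
    fun _ hx => by rwa [sub_zero]
  app_act _ _ _ := rfl

theorem subsingleton_hom_susp {t : ℤ} (ht : t ≠ 0) : Subsingleton (F2 ⟶ F2.susp t) where
  allEq _ _ := evalOne_injective _ (suspVal_injective t 0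
    ((suspVal_of_ne ht.symm _).trans (suspVal_of_ne ht.symm _).symm))

/-! ### Morphisms from the augmentation ideal -/

/-- The augmentation ideal. -/
abbrev augIdeal : GrMod := ker freeToF2

/-- The element of `A` underlying an element of the augmentation ideal. -/
def augIdealVal (j : ℤ) : augIdeal.carrier j →ₗ[ZMod 2] SteenrodAlgebra :=
  (degZ j).subtype ∘ₗ (LinearMap.ker (freeToF2.app j)).subtype

theorem augmentation_augIdeal {j : ℤ} (x : augIdeal.carrier j) :
    augmentation (augIdealVal j x) = 0 :=
  congrArg Subtype.val (x.2 : freeToF2.app j x.1 = 0)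

/-- The element of the augmentation ideal given by `x ∈ A_n` with `n > 0`. -/
def augIdeal.mk {n : ℕ} (hn : 0 < n) {x : SteenrodAlgebra} (hx : x ∈ deg n) :
    augIdeal.carrier (Int.ofNat n) :=
  ⟨(⟨x, hx⟩ : deg n), Subtype.ext (augmentation_deg hn.ne' hx)⟩

/-- Morphisms `A → Σ^t 𝔽₂` vanish on the augmentation ideal. -/
theorem kerι_comp_eq_zero {t : ℤ} (f : free ⟶ F2.susp t) : kerι freeToF2 ≫ f = 0 := by
  refine hom_ext fun j x => ?_
  apply suspVal_injective
  change suspVal t j (f.app j x.1) = suspVal t j 0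
  have hf : f = freeDesc (f.app 0 free.one) := free_hom_ext (freeDesc_one _).symm
  have hx := augmentation_augIdeal x
  rw [hf, map_zero]
  match j, x, hx with
  | Int.ofNat n, x, hx =>
    exact (suspVal_act (i := n) (add_zero _) x.1 _).trans
      ((congrArg (· * _) hx).trans (zero_mul _))
  | Int.negSucc n, x, hx => exact map_zero _

/-- A morphism `I → Σ^t 𝔽₂` vanishes on decomposables. -/
theorem app_decomposables {t : ℤ} (f : augIdeal ⟶ F2.susp t) {n : ℕ} (hn : 0 < n)
    {x : SteenrodAlgebra} (hx : x ∈ deg n) (hd : x ∈ decomposables n) :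
    f.app (Int.ofNat n) (augIdeal.mk hn hx) = 0 := by
  let F : deg n →ₗ[ZMod 2] (F2.susp t).carrier (Int.ofNat n) :=
    { toFun x := f.app (Int.ofNat n) (augIdeal.mk hn x.2)
      map_add' x y := map_add (f.app (Int.ofNat n)) (augIdeal.mk hn x.2) (augIdeal.mk hn y.2)
      map_smul' c x := map_smul (f.app (Int.ofNat n)) c (augIdeal.mk hn x.2) }
  suffices h : decomposables n ≤ (LinearMap.ker F).map (deg n).subtype by
    obtain ⟨y, hy, rfl⟩ := h hd
    exact hy
  refine Submodule.span_le.2 ?_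
  rintro _ ⟨i, j, hi, hj, rfl, x, hx, y, hy, rfl⟩
  refine ⟨⟨x * y, SetLike.GradedMul.mul_mem hx hy⟩, ?_, rfl⟩
  apply suspVal_injective
  have h : suspVal t _ (f.app (Int.ofNat (i + j)) (augIdeal.act (i := i) (j := Int.ofNat j)
      (by simp) ⟨x, hx⟩ (augIdeal.mk hj hy))) = 0 := by
    rw [f.app_act, suspVal_act, augmentation_deg hi.ne' hx, zero_mul]
  exact h.trans (map_zero _).symm

/-- A morphism `I → Σ^t 𝔽₂` can be nonzero only in degree `t`, and is determined there by its
value at `Sq^t`, since `I_t` is spanned by `Sq^t` and decomposables. -/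
theorem augIdeal_hom_eq_zero {t : ℤ} (f : augIdeal ⟶ F2.susp t)
    (h : ∀ (n : ℕ) (hn : 0 < n), t = n → f.app (Int.ofNat n) (augIdeal.mk hn (sq_mem_deg n)) = 0) :
    f = 0 := by
  refine hom_ext fun j x => suspVal_injective t j ?_
  by_cases hj : j = t
  swap
  · rw [suspVal_of_ne hj, suspVal_of_ne hj]
  change _ = suspVal t j 0
  congr 1
  subst hj
  match j, f, h, x with
  | Int.negSucc n, f, h, x =>
    obtain rfl : x = 0 := Subtype.ext (Subtype.ext x.1.2)
    exact map_zero _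
  | Int.ofNat n, f, h, x =>
    rcases Nat.eq_zero_or_pos n with rfl | hn
    · obtain rfl : x = 0 := by
        refine Subtype.ext (Subtype.ext ?_)
        obtain ⟨c, hc⟩ := Submodule.mem_span_singleton.1 (deg_zero_le x.1.2)
        have hx : augmentation (x.1.1 : SteenrodAlgebra) = 0 := augmentation_augIdeal x
        rw [← hc, map_smul, map_one, smul_eq_mul, mul_one] at hx
        rw [← hc, hx, zero_smul]
        rfl
      exact map_zero _
    · obtain ⟨y, hy, d, hd, hyd⟩ :=
        Submodule.mem_sup.1 (deg_le_span_sq_sup_decomposables hn x.1.2)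
      obtain ⟨c, rfl⟩ := Submodule.mem_span_singleton.1 hy
      have hd' : d ∈ deg n := by
        rw [← sub_eq_iff_eq_add'.2 hyd.symm]
        exact Submodule.sub_mem _ x.1.2 (Submodule.smul_mem _ _ (sq_mem_deg n))
      have hx : x = c • augIdeal.mk hn (sq_mem_deg n) + augIdeal.mk hn hd' :=
        Subtype.ext (Subtype.ext hyd.symm)
      rw [hx, map_add, map_smul, h n hn rfl, app_decomposables f hn hd' hd, smul_zero, add_zero]

theorem subsingleton_augIdeal_hom {t : ℤ} (ht : ¬ ∃ i : ℕ, t = 2 ^ i) :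
    Subsingleton (augIdeal ⟶ F2.susp t) :=
  subsingleton_of_forall_eq 0 fun f => augIdeal_hom_eq_zero f fun n hn hnt =>
    app_decomposables f hn (sq_mem_deg n) (sq_mem_decomposables hn fun ⟨i, hi⟩ =>
      ht ⟨i, by rw [hnt, hi, Nat.cast_pow, Nat.cast_ofNat]⟩)

/-- The morphism `I → Σ^{2^k} 𝔽₂` given by `sqDual k` in degree `2^k`. -/
def augIdealDual (k : ℕ) : augIdeal ⟶ F2.susp (Int.ofNat (2 ^ k)) where
  app _ := toSusp _ _ (sqDual k ∘ₗ augIdealVal _)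
  app_act {i j l} h a x := by
    apply suspVal_injective
    rw [suspVal_act, suspVal_toSusp, suspVal_toSusp]
    have e : sqDual k (augIdealVal l (augIdeal.act h a x)) =
        augmentation a * sqDual k (augIdealVal j x) := by
      refine (sqDual_mul k a.1 (augIdealVal j x)).trans ?_
      rw [augmentation_augIdeal x, zero_mul, add_zero]
    -- If exactly one of the source and target degrees is `2^k`, then `a` has positive degree.
    split_ifs with hl hj hj
    · exact e
    · refine e.trans ?_
      rw [augmentation_deg (by rintro rfl; omega) a.2, zero_mul, zero_mul]
    · rw [augmentation_deg (by rintro rfl; omega) a.2, zero_mul]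
      rfl
    · exact (mul_zero _).symm

/-- The value at `Sq^n` of a morphism `I → Σ^n 𝔽₂`. -/
def evalSq {n : ℕ} (hn : 0 < n) : (augIdeal ⟶ F2.susp (Int.ofNat n)) →ₗ[ZMod 2] ZMod 2 where
  toFun f := suspVal _ _ (f.app (Int.ofNat n) (augIdeal.mk hn (sq_mem_deg n)))
  map_add' _ _ := rfl
  map_smul' _ _ := rfl

theorem evalSq_injective {n : ℕ} (hn : 0 < n) : Function.Injective (evalSq hn) := by
  rw [injective_iff_map_eq_zero]
  intro f hf
  refine augIdeal_hom_eq_zero f fun m hm hmn => ?_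
  obtain rfl : n = m := Int.ofNat.inj hmn
  exact suspVal_injective _ _ (hf.trans (map_zero _).symm)

theorem evalSq_augIdealDual (k : ℕ) : evalSq (Nat.two_pow_pos k) (augIdealDual k) = 1 := by
  refine (suspVal_toSusp _ _).trans ?_
  rw [if_pos rfl]
  exact sqDual_sq k

end GrMod

/-! ### Dimension shifting -/

/-- Dimension shifting: if `X₂` is projective and every morphism `X₂ ⟶ Y` vanishes on `X₁`, the
connecting map `Hom(X₁, Y) → Ext¹(X₃, Y)` is an isomorphism. -/
theorem nonempty_hom_linearEquiv_ext_one {C : Type*} [Category C] [Abelian C] {R : Type*}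
    [CommRing R] [Linear R C] [HasExt C] {S : ShortComplex C} (hS : S.ShortExact)
    [Projective S.X₂] (Y : C) (h : ∀ f : S.X₂ ⟶ Y, S.f ≫ f = 0) :
    Nonempty ((S.X₁ ⟶ Y) ≃ₗ[R] Abelian.Ext S.X₃ Y 1) := by
  refine ⟨(Abelian.Ext.linearEquiv₀ (R := R)).symm.trans (LinearEquiv.ofBijective
    (Abelian.Ext.precompOfLinear hS.extClass R Y (add_zero 1)) ⟨?_, fun x => ?_⟩)⟩
  · rw [injective_iff_map_eq_zero]
    intro x hx
    obtain ⟨y, rfl⟩ := Abelian.Ext.contravariant_sequence_exact₁ hS _ x (add_zero 1) hx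
    obtain ⟨f, rfl⟩ := Abelian.Ext.addEquiv₀.symm.surjective y
    refine (Abelian.Ext.mk₀_comp_mk₀ _ _).trans ?_
    rw [h, Abelian.Ext.mk₀_zero]
  · exact Abelian.Ext.contravariant_sequence_exact₃ hS _ x
      (Abelian.Ext.eq_zero_of_projective _) (add_zero 1)

theorem bijective_of_injective_of_eq_one {V : Type*} [AddCommGroup V] [Module (ZMod 2) V]
    (e : V →ₗ[ZMod 2] ZMod 2) (he : Function.Injective e) {v : V} (hv : e v = 1) :
    Function.Bijective e :=
  ⟨he, fun c => ⟨c • v, by rw [map_smul, hv, smul_eq_mul, mul_one]⟩⟩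

theorem span_singleton_eq_top_of_eq_one {V : Type*} [AddCommGroup V] [Module (ZMod 2) V]
    (e : V →ₗ[ZMod 2] ZMod 2) (he : Function.Injective e) {v : V} (hv : e v = 1) :
    Submodule.span (ZMod 2) {v} = ⊤ := by
  refine (Submodule.eq_top_iff'.2 fun w => Submodule.mem_span_singleton.2 ⟨e w, he ?_⟩)
  rw [map_smul, hv, smul_eq_mul, mul_one]

theorem GrMod.nonempty_augIdeal_hom_linearEquiv_ext_one (t : ℤ) :
    Nonempty ((augIdeal ⟶ F2.susp t) ≃ₗ[ZMod 2] Abelian.Ext F2 (F2.susp t) 1) :=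
  haveI : Projective augSeq.X₂ := projective_free
  nonempty_hom_linearEquiv_ext_one augSeq_shortExact _ kerι_comp_eq_zero

end Steenrod

end

open Steenrod.GrMod in
theorem mainTheorem2 :
    (Nonempty ((Steenrod.GrMod.F2 ⟶ Steenrod.GrMod.F2) ≃ₗ[ZMod 2] ZMod 2) ∧
      Submodule.span (ZMod 2) {𝟙 Steenrod.GrMod.F2} = ⊤) ∧
    Nonempty ((Steenrod.GrMod.F2 ⟶ Steenrod.GrMod.F2.susp 0) ≃ₗ[ZMod 2] ZMod 2) ∧
    (∀ t : ℤ, t ≠ 0 →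
      Subsingleton (Steenrod.GrMod.F2 ⟶ Steenrod.GrMod.F2.susp t)) ∧
    (∀ t : ℤ, (∃ i : ℕ, t = 2 ^ i) →
      Nonempty (Abelian.Ext Steenrod.GrMod.F2 (Steenrod.GrMod.F2.susp t) 1 ≃ₗ[ZMod 2] ZMod 2)) ∧
    (∀ t : ℤ, (¬ ∃ i : ℕ, t = 2 ^ i) →
      Subsingleton (Abelian.Ext Steenrod.GrMod.F2 (Steenrod.GrMod.F2.susp t) 1)) := by
  let e : (F2 ⟶ F2) →ₗ[ZMod 2] ZMod 2 := (F2part 0).subtype ∘ₗ evalOne F2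
  have he : Function.Injective e := Subtype.val_injective.comp (evalOne_injective F2)
  let e' : (F2 ⟶ F2.susp 0) →ₗ[ZMod 2] ZMod 2 := suspVal 0 0 ∘ₗ evalOne (F2.susp 0)
  have he' : Function.Injective e' := (suspVal_injective 0 0).comp (evalOne_injective _)
  refine ⟨⟨⟨.ofBijective e (Steenrod.bijective_of_injective_of_eq_one e he (v := 𝟙 F2) rfl)⟩,
    Steenrod.span_singleton_eq_top_of_eq_one e he rfl⟩,
    ⟨.ofBijective e' (Steenrod.bijective_of_injective_of_eq_one e' he' (v := toSuspZero) rfl)⟩,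
    fun t ht => subsingleton_hom_susp ht, ?_, fun t ht => ?_⟩
  · rintro t ⟨i, hi⟩
    obtain rfl : t = Int.ofNat (2 ^ i) := by simp [hi]
    obtain ⟨E⟩ := nonempty_augIdeal_hom_linearEquiv_ext_one (Int.ofNat (2 ^ i))
    exact ⟨E.symm.trans (.ofBijective _ (Steenrod.bijective_of_injective_of_eq_one
      (evalSq (Nat.two_pow_pos i)) (evalSq_injective _) (evalSq_augIdealDual i)))⟩
  · obtain ⟨E⟩ := nonempty_augIdeal_hom_linearEquiv_ext_one t
    have := subsingleton_augIdeal_hom ht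
    exact E.symm.toEquiv.subsingleton
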